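/- All entropies and (conditional) mutual informations are in bits, and random variables are discrete. \textbf{Tension.} For jointly distributed $A,B$ with finite alphabets let \[\mathfrak T(A;B)=\{(r_1,r_2,r_3)\in\mathbb R^3:\ \exists\, Q \text{ jointly distributed with } (A,B) \text{ s.t. } I(B;Q|A)\le r_1,\ I(A;Q|B)\le r_2,\ I(A;B|Q)\le r_3\},\] and for $c\ge 0$ let $\mathfrak T_c(A;B)=\{(r_1,r_2)\in\mathbb R_+^2: (r_1,r_2,c)\in\mathfrak T(A;B)\}$, where $\mathbb R_+=[0,\infty)$. For $v\in\mathbb R^2$ and $S,S_1,S_2\subseteq\mathbb R^2$ let $v+S=\{v+s:s\in S\}$ and $S_1-S_2=\{v\in\mathbb R_+^2: v+S_2\subseteq S_1\}$. \textbf{Protocols.} A (randomized, private-coin) two-party protocol $\Pi$ specifies which party sends first and, for each party, a map from its current view (its input and the transcript so far) to the distribution of its next message (a finite bit string) together with an optional output. The parties alternate sending messages; a party that produces an output halts, and the run is complete when both have produced an output. There is no bound on the number of rounds. We write $\Pi(X;Y)\mapsto(A;B)$ if, on inputs distributed as $(X,Y)$, the run is almost surely complete and the outputs $A$ of the first-named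 party (with input $X$) and $B$ of the other (with input $Y$) have the prescribed joint distribution with $(X,Y)$; $M$ denotes the complete transcript (the sequence of messages). The information complexity region is \[\mathfrak I(X;Y\to A;B)=\{(r_1,r_2)\in\mathbb R_+^2:\ \exists\,\Pi \text{ s.t. } \Pi(X;Y)\mapsto(A;B),\ I(X;M|Y)\le r_1,\ I(Y;M|X)\le r_2\}.\] \textbf{Theorem.} Let $X,Y,A,B$ be jointly distributed random variables with finite alphabets, and let \[\mathfrak R(X;Y\to A;B)=\bigcap_{c\ge0}\big(\mathfrak T_c(BY;AX)-\mathfrak T_c(Y;X)\big).\] Then \[\mathfrak I(X;Y\to A;B)\ \subseteq\ \big(H(B|Y)-H(AB|XY),\ H(A|X)-H(AB|XY)\big)+\mathfrak R(X;Y\to A;B).\] In particular, if $H(A|X)\ge H(AB|XY)$ and $H(B|Y)\ge H(AB|XY)$, then $\mathfrak I(X;Y\to A;B)\subseteq\mathfrak R(X;Y\to A;B)$. -/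

import Mathlib

noncomputable section

namespace TwoParty

/-! ### Entropy and conditional mutual information of discrete random variables (in bits)

Random variables are functions on a discrete probability space `(Ω, P)`. -/

/-- The probability `P[f = a]`. -/
def pr {Ω α : Type*} (P : PMF Ω) (f : Ω → α) (a : α) : ℝ := (P.map f a).toReal

/-- Conditional entropy `H(f | h) = ∑_c P[h = c] · H(f | h = c)`, in bits. As `f` takes finitely many
values the inner entropy is bounded, so the series over `c` always converges. -/
def condEntropy {Ω α γ : Type*} [Fintype α] (P : PMF Ω) (f : Ω → α) (h : Ω → γ) : ℝ :=
  ∑' c : γ, pr P h c *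
    ((∑ a : α, Real.negMulLog (pr P (fun ω => (f ω, h ω)) (a, c) / pr P h c)) / Real.log 2)

/-- Conditional mutual information `I(f ; g | h) = H(f | h) - H(f | g, h)`, in bits, for a finitely
valued `f` and arbitrary discrete `g`, `h`. -/
def condMutualInfo {Ω α β γ : Type*} [Fintype α] (P : PMF Ω) (f : Ω → α) (g : Ω → β) (h : Ω → γ) :
    ℝ :=
  condEntropy P f h - condEntropy P f (fun ω => (g ω, h ω))

/-! ### Tension -/

/-- The tension region `𝔗(A ; B)` of a pair `(A, B)` with joint law `p`: all `(r₁, r₂, r₃)` for which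
there is a discrete `Q` jointly distributed with `(A, B)` such that
`I(B ; Q | A) ≤ r₁`, `I(A ; Q | B) ≤ r₂`, `I(A ; B | Q) ≤ r₃`.
`P` is the joint law of `(A, B, Q)`. -/
def tensionRegion {α β : Type*} [Fintype α] [Fintype β] (p : PMF (α × β)) : Set (ℝ × ℝ × ℝ) :=
  {r | ∃ (κ : Type) (P : PMF (α × β × κ)),
    P.map (fun ω => (ω.1, ω.2.1)) = p ∧
    condMutualInfo P (fun ω => ω.2.1) (fun ω => ω.2.2) (fun ω => ω.1) ≤ r.1 ∧
    condMutualInfo P (fun ω => ω.1) (fun ω => ω.2.2) (fun ω => ω.2.1) ≤ r.2.1 ∧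
    condMutualInfo P (fun ω => ω.1) (fun ω => ω.2.1) (fun ω => ω.2.2) ≤ r.2.2}

/-- The slice `𝔗_c(A ; B) ⊆ ℝ₊²` of the tension region at height `r₃ = c`. -/
def tensionSlice {α β : Type*} [Fintype α] [Fintype β] (c : ℝ) (p : PMF (α × β)) : Set (ℝ × ℝ) :=
  {r | 0 ≤ r.1 ∧ 0 ≤ r.2 ∧ (r.1, r.2, c) ∈ tensionRegion p}

/-- The translate `v + S` of a planar region. -/
def translate (v : ℝ × ℝ) (S : Set (ℝ × ℝ)) : Set (ℝ × ℝ) := (fun s => v + s) '' S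

/-- The difference `S₁ - S₂ = {v ∈ ℝ₊² : v + S₂ ⊆ S₁}` of planar regions. -/
def regionDiff (S₁ S₂ : Set (ℝ × ℝ)) : Set (ℝ × ℝ) :=
  {v | 0 ≤ v.1 ∧ 0 ≤ v.2 ∧ translate v S₂ ⊆ S₁}

/-! ### Randomized two-party protocols with private coins -/

/-- A message is a finite bit string; a transcript is the list of the messages sent, oldest first. -/
abbrev Transcript := List (List Bool)

/-- A two-party protocol: which party sends first and, for each party, the map from its current view
(its input and the transcript so far) to the joint distribution of its next message and its optional
output. Transcripts keep the boundaries between messages, so no condition is needed to make messages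
parsable: every protocol with self-terminating messages is among these. -/
structure Protocol (𝒳 𝒴 𝒜 ℬ : Type*) where
  aliceFirst : Bool
  alice : 𝒳 → Transcript → PMF (List Bool × Option 𝒜)
  bob : 𝒴 → Transcript → PMF (List Bool × Option ℬ)

/-- A configuration of a run: the transcript so far and the outputs produced so far. -/
structure Config (𝒜 ℬ : Type*) where
  transcript : Transcript
  outA : Option 𝒜
  outB : Option ℬ

namespace Protocol

variable {𝒳 𝒴 𝒜 ℬ : Type*}

open Classical in
/-- One turn of a run on inputs `x`, `y`. The parties alternate, so Alice moves at the transcripts of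
even length if she is first and at those of odd length otherwise. A party that has produced an
output has halted: it makes no further move. -/
def step (Pi : Protocol 𝒳 𝒴 𝒜 ℬ) (x : 𝒳) (y : 𝒴) (s : Config 𝒜 ℬ) : PMF (Config 𝒜 ℬ) :=
  if (Even s.transcript.length ↔ Pi.aliceFirst = true) then
    match s.outA with
    | some _ => PMF.pure s
    | none => (Pi.alice x s.transcript).map fun d => ⟨s.transcript ++ [d.1], d.2, s.outB⟩
  else
    match s.outB with
    | some _ => PMF.pure s
    | none => (Pi.bob y s.transcript).map fun d => ⟨s.transcript ++ [d.1], s.outA, d.2⟩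

/-- The law of the configuration after `n` turns, on inputs `x`, `y`. -/
def run (Pi : Protocol 𝒳 𝒴 𝒜 ℬ) (x : 𝒳) (y : 𝒴) : ℕ → PMF (Config 𝒜 ℬ)
  | 0 => PMF.pure ⟨[], none, none⟩
  | n + 1 => (Pi.run x y n).bind (Pi.step x y)

/-- The probability that the run on inputs `x`, `y` ends with complete transcript `m` and with outputs
`a` of Alice and `b` of Bob. Configurations with both outputs are final, so the supremum is the limit
as the number of turns grows; there is no bound on the number of turns. -/
def finalProb (Pi : Protocol 𝒳 𝒴 𝒜 ℬ) (x : 𝒳) (y : 𝒴) (a : 𝒜) (b : ℬ) (m : Transcript) : ENNReal :=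
  ⨆ n, Pi.run x y n ⟨m, some a, some b⟩

/-- `Π(X ; Y) ↦ (A ; B)` with transcript `M`, where `p` is the joint law of `(X, Y, A, B)` and `P` that
of `(X, Y, A, B, M)`: on inputs distributed as `(X, Y)`, the run almost surely ends (as `P` has total
mass one) and the inputs, outputs and transcript have the joint law `P`, with marginal `p` on
`(X, Y, A, B)`. -/
def Computes (Pi : Protocol 𝒳 𝒴 𝒜 ℬ) (p : PMF (𝒳 × 𝒴 × 𝒜 × ℬ))
    (P : PMF (𝒳 × 𝒴 × 𝒜 × ℬ × Transcript)) : Prop :=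
  (∀ x y a b m, P (x, y, a, b, m) =
    p.map (fun ω => (ω.1, ω.2.1)) (x, y) * Pi.finalProb x y a b m) ∧
  P.map (fun ω => (ω.1, ω.2.1, ω.2.2.1, ω.2.2.2.1)) = p

end Protocol

/-! ### The regions

`p` is the joint law of `(X, Y, A, B)`. -/

section Regions

variable {𝒳 𝒴 𝒜 ℬ : Type*} [Fintype 𝒳] [Fintype 𝒴] [Fintype 𝒜] [Fintype ℬ]

/-- The information complexity region of computing `(A ; B)` from `(X ; Y)`: all `(r₁, r₂) ∈ ℝ₊²` such
that some protocol computes `(A ; B)` from `(X ; Y)` with a transcript `M` satisfying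
`I(X ; M | Y) ≤ r₁` and `I(Y ; M | X) ≤ r₂`. -/
def icRegion (p : PMF (𝒳 × 𝒴 × 𝒜 × ℬ)) : Set (ℝ × ℝ) :=
  {r | 0 ≤ r.1 ∧ 0 ≤ r.2 ∧
    ∃ (Pi : Protocol 𝒳 𝒴 𝒜 ℬ) (P : PMF (𝒳 × 𝒴 × 𝒜 × ℬ × Transcript)), Pi.Computes p P ∧
      condMutualInfo P (fun ω => ω.1) (fun ω => ω.2.2.2.2) (fun ω => ω.2.1) ≤ r.1 ∧
      condMutualInfo P (fun ω => ω.2.1) (fun ω => ω.2.2.2.2) (fun ω => ω.1) ≤ r.2}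

/-- `H(A | X)`. -/
def entropyAX (p : PMF (𝒳 × 𝒴 × 𝒜 × ℬ)) : ℝ := condEntropy p (fun ω => ω.2.2.1) (fun ω => ω.1)

/-- `H(B | Y)`. -/
def entropyBY (p : PMF (𝒳 × 𝒴 × 𝒜 × ℬ)) : ℝ := condEntropy p (fun ω => ω.2.2.2) (fun ω => ω.2.1)

/-- `H(A, B | X, Y)`. -/
def entropyABXY (p : PMF (𝒳 × 𝒴 × 𝒜 × ℬ)) : ℝ :=
  condEntropy p (fun ω => (ω.2.2.1, ω.2.2.2)) (fun ω => (ω.1, ω.2.1))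

/-- The outer region `⋂_{c ≥ 0} (𝔗_c(B, Y ; A, X) - 𝔗_c(Y ; X))`. -/
def outerRegion (p : PMF (𝒳 × 𝒴 × 𝒜 × ℬ)) : Set (ℝ × ℝ) :=
  ⋂ (c : ℝ) (_ : 0 ≤ c),
    regionDiff (tensionSlice c (p.map fun ω => ((ω.2.2.2, ω.2.1), (ω.2.2.1, ω.1))))
      (tensionSlice c (p.map fun ω => (ω.2.1, ω.1)))

/-- The outer region shifted by `(H(B | Y) - H(A, B | X, Y), H(A | X) - H(A, B | X, Y))`. -/
def shiftedOuterRegion (p : PMF (𝒳 × 𝒴 × 𝒜 × ℬ)) : Set (ℝ × ℝ) :=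
  translate (entropyBY p - entropyABXY p, entropyAX p - entropyABXY p) (outerRegion p)

end Regions

end TwoParty

end

/-! Let `Q` witness a point of the tension region of the inputs. Couple it with a run so that `Q`
and (A, B, M) are independent given (X, Y). Then the pair (Q, M) witnesses the required point for
the views (`Protocol.Computes.add_mem_tensionRegion`).

The protocol enters through one fact: with private coins, the law of (A, B, M) given (X, Y) is a
product f(x, a, m) g(y, b, m) (`Protocol.exists_finalProb_eq_mul`). Together with the independence
of `Q` this is the structure `Factors`, which has two consequences.

(1) I(X; Q, M | Y) ≤ I(X; M | Y) + I(X; Q | Y), because Q and M are independent given (X, Y).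
Moreover B says nothing about X once (Q, M, Y) is known, so H(A, X | Q, M, B, Y) ≥ H(X | Q, M, Y).
Both are merged in `Factors.condEntropy_add_le`. By `condEntropy_chain`, H(A, X | B, Y) = H(X | Y) +
H(A, B | X, Y) - H(B | Y); the shift of the region comes from here.

(2) I(B, Y; A, X | Q, M) ≤ I(Y; X | Q). Compare the true law with the one where X and Y are made
independent given Q and the same kernel f g is applied. The kernel cancels, so the divergence is
I(Y; X | Q). Given (Q, M) the comparison law is a product, so the chain rule splits this divergence
into I(B, Y; A, X | Q, M) and nonnegative terms (`Factors.condMutualInfo_le`).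

The shifted point is nonnegative by (1) with constant Q. The information inequalities are Gibbs
inequalities: log Z ≤ Z - 1 pointwise, with E Z ≤ 1 (`nonpos_of_hasSum`). -/

namespace TwoParty

open scoped ENNReal

/-! ### Conditional entropy as expected surprisal, and Gibbs inequalities -/

section Information

variable {Ω α β γ : Type*}

lemma tsum_mul_comp (P : PMF Ω) (g : Ω → β) (F : β → ℝ≥0∞) :
    ∑' ω, P ω * F (g ω) = ∑' b, P.map g b * F b := by
  classical
  simp only [PMF.map_apply, ← ENNReal.tsum_mul_right]
  rw [ENNReal.tsum_comm]
  refine tsum_congr fun ω => ?_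
  rw [tsum_eq_single (g ω)]
  · simp
  · intro b hb
    simp [hb]

lemma map_comp_injective (P : PMF Ω) (g : Ω → β) {e : β → γ} (he : Function.Injective e) (b : β) :
    P.map (fun ω => e (g ω)) (e b) = P.map g b := by
  classical
  simp [PMF.map_apply, he.eq_iff]

lemma tsum_map_prod (P : PMF Ω) (f : Ω → α) (g : Ω → β) (a : α) :
    ∑' b, P.map (fun ω => (f ω, g ω)) (a, b) = P.map f a := by
  classical
  simp only [PMF.map_apply, Prod.mk.injEq]
  rw [ENNReal.tsum_comm]
  refine tsum_congr fun ω => ?_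
  rw [tsum_eq_single (g ω)]
  · simp
  · intro b hb
    simp [hb]

lemma tsum_map_prod_left (P : PMF Ω) (f : Ω → α) (g : Ω → β) (b : β) :
    ∑' a, P.map (fun ω => (f ω, g ω)) (a, b) = P.map g b := by
  rw [← tsum_map_prod P g f b]
  exact tsum_congr fun a =>
    (map_comp_injective P (fun ω => (f ω, g ω)) Prod.swap_injective (a, b)).symm

lemma map_apply_ne_zero (P : PMF Ω) (g : Ω → β) {ω : Ω} (h : P ω ≠ 0) : P.map g (g ω) ≠ 0 := by
  rw [← PMF.mem_support_iff, PMF.mem_support_map_iff]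
  exact ⟨ω, (PMF.mem_support_iff _ _).2 h, rfl⟩

lemma map_apply_le_of_comp (P : PMF Ω) (g : Ω → β) (e : β → γ) (b : β) :
    P.map g b ≤ P.map (fun ω => e (g ω)) (e b) := by
  classical
  simp only [PMF.map_apply]
  refine ENNReal.tsum_le_tsum fun ω => ?_
  by_cases h : b = g ω <;> simp [h]

/-- This supplies E Z ≤ 1 in the Gibbs arguments: Z is a comparison weight `w` divided by the true
law of `g`. Only an inequality holds, since mass of `w` at null values of `g` is lost. -/
lemma tsum_div_map_le (P : PMF Ω) (g : Ω → β) (w : β → ℝ≥0∞) :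
    ∑' ω, P ω * (w (g ω) / P.map g (g ω)) ≤ ∑' b, w b := by
  rw [tsum_mul_comp P g fun b => w b / P.map g b]
  exact ENNReal.tsum_le_tsum fun b => ENNReal.mul_div_le

lemma pr_pos (P : PMF Ω) (g : Ω → β) {ω : Ω} (h : P ω ≠ 0) : 0 < pr P g (g ω) :=
  ENNReal.toReal_pos (map_apply_ne_zero P g h) (PMF.apply_ne_top _ _)

lemma pr_nonneg (P : PMF Ω) (g : Ω → β) (b : β) : 0 ≤ pr P g b := ENNReal.toReal_nonneg

lemma pr_prod_le (P : PMF Ω) (f : Ω → α) (h : Ω → γ) (a : α) (c : γ) :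
    pr P (fun ω => (f ω, h ω)) (a, c) ≤ pr P h c :=
  ENNReal.toReal_mono (PMF.apply_ne_top _ _)
    (map_apply_le_of_comp P (fun ω => (f ω, h ω)) Prod.snd (a, c))

/-- Conditional entropy is the expectation of the conditional surprisal. -/
lemma hasSum_condEntropy [Fintype α] (P : PMF Ω) (f : Ω → α) (h : Ω → γ) :
    HasSum (fun ω => (P ω).toReal *
      -Real.log (pr P (fun ω => (f ω, h ω)) (f ω, h ω) / pr P h (h ω)))
      (condEntropy P f h * Real.log 2) := by
  set j : α → γ → ℝ := fun a c => pr P (fun ω => (f ω, h ω)) (a, c) with hj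
  have hu0 : ∀ a c, 0 ≤ j a c / pr P h c := fun a c => div_nonneg (pr_nonneg _ _ _) (pr_nonneg _ _ _)
  have hu1 : ∀ a c, j a c / pr P h c ≤ 1 := fun a c =>
    div_le_one_of_le₀ (pr_prod_le P f h a c) (pr_nonneg _ _ _)
  have hF0 : ∀ a c, 0 ≤ -Real.log (j a c / pr P h c) := fun a c =>
    neg_nonneg.2 (Real.log_nonpos (hu0 a c) (hu1 a c))
  have hmul : ∀ a c, pr P h c * Real.negMulLog (j a c / pr P h c) =
      j a c * -Real.log (j a c / pr P h c) := by
    intro a c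
    -- For a null `c` the quotient is the default 0, and the joint probability vanishes too.
    rcases eq_or_ne (pr P h c) 0 with h0 | h0
    · have : j a c = 0 := le_antisymm (h0 ▸ pr_prod_le P f h a c) (pr_nonneg _ _ _)
      simp [h0, this]
    · rw [Real.negMulLog]
      field_simp
  set t : γ → ℝ := fun c => ∑ a, j a c * -Real.log (j a c / pr P h c) with ht
  have ht0 : ∀ c, 0 ≤ t c := fun c =>
    Finset.sum_nonneg fun a _ => mul_nonneg (pr_nonneg _ _ _) (hF0 a c)
  have hsum : Summable t := by
    have hpr : Summable fun c => pr P h c := ENNReal.summable_toReal (PMF.tsum_coe_ne_top _)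
    refine Summable.of_nonneg_of_le ht0 (fun c => ?_) (hpr.mul_right (Fintype.card α : ℝ))
    have : ∀ a ∈ Finset.univ, j a c * -Real.log (j a c / pr P h c) ≤ pr P h c := by
      intro a _
      rw [← hmul]
      refine mul_le_of_le_one_right (pr_nonneg _ _ _) ?_
      have := Real.negMulLog_le_one_sub_self (hu0 a c)
      linarith [hu0 a c]
    refine (Finset.sum_le_sum this).trans ?_
    simp [mul_comm]
  have hent : condEntropy P f h * Real.log 2 = ∑' c, t c := by
    rw [condEntropy, ← tsum_mul_right]
    refine tsum_congr fun c => ?_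
    have h2 : Real.log 2 ≠ 0 := (Real.log_pos one_lt_two).ne'
    rw [mul_assoc, div_mul_cancel₀ _ h2, Finset.mul_sum]
    exact Finset.sum_congr rfl fun a _ => hmul a c
  -- Surprisals are nonnegative, so the sums can be rearranged freely in `ℝ≥0∞`; the finite value
  -- then yields real summability over Ω.
  have hE : ∑' ω, P ω * ENNReal.ofReal (-Real.log (j (f ω) (h ω) / pr P h (h ω))) =
      ENNReal.ofReal (∑' c, t c) := by
    rw [tsum_mul_comp P (fun ω => (f ω, h ω))
      fun b => ENNReal.ofReal (-Real.log (j b.1 b.2 / pr P h b.2)),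
      ENNReal.tsum_prod', ENNReal.tsum_comm, ENNReal.ofReal_tsum_of_nonneg ht0 hsum]
    refine tsum_congr fun c => ?_
    rw [tsum_fintype, ht, ENNReal.ofReal_sum_of_nonneg
      fun a _ => mul_nonneg (pr_nonneg _ _ _) (hF0 a c)]
    refine Finset.sum_congr rfl fun a _ => ?_
    rw [ENNReal.ofReal_mul (pr_nonneg _ _ _)]
    exact congrArg₂ _ (ENNReal.ofReal_toReal (PMF.apply_ne_top _ _)).symm rfl
  have hne : ∑' ω, P ω * ENNReal.ofReal (-Real.log (j (f ω) (h ω) / pr P h (h ω))) ≠ ⊤ :=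
    hE ▸ ENNReal.ofReal_ne_top
  have hs := ENNReal.hasSum_toReal hne
  rw [← ENNReal.tsum_toReal_eq (fun ω => ENNReal.ne_top_of_tsum_ne_top hne ω), hE,
    ENNReal.toReal_ofReal (tsum_nonneg ht0), ← hent] at hs
  convert hs using 2 with ω
  rw [ENNReal.toReal_mul, ENNReal.toReal_ofReal (hF0 _ _)]

lemma pr_map {Ω' : Type*} (P : PMF Ω) (g : Ω → Ω') (f : Ω' → α) (a : α) :
    pr (P.map g) f a = pr P (fun ω => f (g ω)) a := by
  rw [pr, PMF.map_comp]; rfl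

lemma condEntropy_map {Ω' : Type*} [Fintype α] (P : PMF Ω) (g : Ω → Ω') (f : Ω' → α) (h : Ω' → γ) :
    condEntropy (P.map g) f h = condEntropy P (fun ω => f (g ω)) (fun ω => h (g ω)) := by
  simp only [condEntropy, pr_map]

lemma pr_comp_injective (P : PMF Ω) (g : Ω → β) {e : β → γ} (he : Function.Injective e) (b : β) :
    pr P (fun ω => e (g ω)) (e b) = pr P g b := by
  rw [pr, map_comp_injective P g he, pr]

lemma tsum_div_const_le_one {ι : Type*} (f : ι → ℝ≥0∞) : ∑' i, f i / ∑' j, f j ≤ 1 := by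
  simp only [div_eq_mul_inv, ENNReal.tsum_mul_right]
  exact ENNReal.div_self_le_one

/-- An expectation bounded above by that of `Z - k`, where `E Z ≤ k`, is nonpositive. -/
lemma nonpos_of_hasSum (P : PMF Ω) {φ : Ω → ℝ} {S : ℝ}
    (hS : HasSum (fun ω => (P ω).toReal * φ ω) S) (Z : Ω → ℝ≥0∞) (k : ℕ)
    (hZ : ∑' ω, P ω * Z ω ≤ k) (hφ : ∀ ω, P ω ≠ 0 → φ ω ≤ (Z ω).toReal - k) : S ≤ 0 := by
  have hne : ∑' ω, P ω * Z ω ≠ ⊤ := ne_top_of_le_ne_top (ENNReal.natCast_ne_top k) hZ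
  have h1 := ENNReal.hasSum_toReal hne
  rw [← ENNReal.tsum_toReal_eq (fun ω => ENNReal.ne_top_of_tsum_ne_top hne ω)] at h1
  have h2 := ENNReal.hasSum_toReal (PMF.tsum_coe_ne_top P)
  rw [← ENNReal.tsum_toReal_eq (PMF.apply_ne_top P), PMF.tsum_coe, ENNReal.toReal_one] at h2
  have h3 := hasSum_le (fun ω => ?_) hS (h1.sub (h2.mul_right (k : ℝ)))
  · have h4 : (∑' ω, P ω * Z ω).toReal ≤ k := by
      simpa using ENNReal.toReal_mono (ENNReal.natCast_ne_top k) hZ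
    linarith
  · rcases eq_or_ne (P ω) 0 with h0 | h0
    · simp [h0]
    · rw [ENNReal.toReal_mul, ← mul_sub]
      exact mul_le_mul_of_nonneg_left (hφ ω h0) ENNReal.toReal_nonneg

/-- Conditional entropy is invariant under injective relabelling. -/
lemma condEntropy_comp_injective {δ : Type*} [Fintype α] [Fintype δ] (P : PMF Ω) (f : Ω → α)
    (h : Ω → β) {d : α → δ} (hd : Function.Injective d) {e : β → γ} (he : Function.Injective e) :
    condEntropy P (fun ω => d (f ω)) (fun ω => e (h ω)) = condEntropy P f h := by
  have h1 := hasSum_condEntropy P f h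
  have h2 := hasSum_condEntropy P (fun ω => d (f ω)) fun ω => e (h ω)
  have key : ∀ ω, pr P (fun ω => (d (f ω), e (h ω))) (d (f ω), e (h ω)) /
      pr P (fun ω => e (h ω)) (e (h ω)) =
      pr P (fun ω => (f ω, h ω)) (f ω, h ω) / pr P h (h ω) := by
    intro ω
    rw [pr_comp_injective P h he]
    congr 1
    exact pr_comp_injective P (fun ω => (f ω, h ω)) (e := Prod.map d e) (hd.prodMap he) (f ω, h ω)
  simp only [key] at h2
  exact mul_right_cancel₀ (Real.log_pos one_lt_two).ne' (h2.unique h1)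

/-- Conditioning reduces entropy. -/
lemma condEntropy_prod_le [Fintype α] (P : PMF Ω) (f : Ω → α) (g : Ω → β) (h : Ω → γ) :
    condEntropy P f (fun ω => (g ω, h ω)) ≤ condEntropy P f h := by
  have h1 := (hasSum_condEntropy P f fun ω => (g ω, h ω)).sub (hasSum_condEntropy P f h)
  simp only [← mul_sub] at h1
  rw [← sub_mul] at h1
  -- Z compares the true law with the one that makes `f` and `g` independent given `h`.
  refine sub_nonpos.1 (nonpos_of_mul_nonpos_left (nonpos_of_hasSum P h1
    (fun ω => P.map (fun ω => (f ω, h ω)) (f ω, h ω) * (P.map (fun ω => (g ω, h ω)) (g ω, h ω) /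
      P.map h (h ω)) / P.map (fun ω => (h ω, f ω, g ω)) (h ω, f ω, g ω)) 1 ?_ fun ω hω => ?_)
      (Real.log_pos one_lt_two))
  · refine (tsum_div_map_le P (fun ω => (h ω, f ω, g ω)) fun b =>
      P.map (fun ω => (f ω, h ω)) (b.2.1, b.1) * (P.map (fun ω => (g ω, h ω)) (b.2.2, b.1) /
      P.map h b.1)).trans ?_
    simp only [ENNReal.tsum_prod', ENNReal.tsum_mul_left, div_eq_mul_inv, ENNReal.tsum_mul_right,
      tsum_map_prod_left, Nat.cast_one]
    rw [← PMF.tsum_coe (P.map h)]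
    exact ENNReal.tsum_le_tsum fun c => mul_le_of_le_one_right' ENNReal.div_self_le_one
  · have e1 := pr_comp_injective P (fun ω => (f ω, g ω, h ω))
      (e := fun b => (b.2.2, b.1, b.2.1)) (fun a b h => by grind) (f ω, g ω, h ω)
    have p1 := pr_pos P (fun ω => (f ω, g ω, h ω)) hω
    have p2 := pr_pos P (fun ω => (g ω, h ω)) hω
    have p3 := pr_pos P (fun ω => (f ω, h ω)) hω
    have p4 := pr_pos P h hω
    have hlog := Real.log_le_sub_one_of_pos (div_pos (mul_pos p3 (div_pos p2 p4)) p1)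
    rw [Real.log_div (by positivity) (by positivity), Real.log_mul (by positivity) (by positivity),
      Real.log_div (by positivity) (by positivity)] at hlog
    rw [Real.log_div (by positivity) (by positivity), Real.log_div (by positivity) (by positivity)]
    simp only [ENNReal.toReal_div, ENNReal.toReal_mul, Nat.cast_one]
    change _ ≤ pr P (fun ω => (f ω, h ω)) (f ω, h ω) * (pr P (fun ω => (g ω, h ω)) (g ω, h ω) /
      pr P h (h ω)) / pr P (fun ω => (h ω, f ω, g ω)) (h ω, f ω, g ω) - 1
    rw [e1]
    linarith

/-- The chain rule applied to `H(A, B, X | Y)` in two ways. -/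
lemma condEntropy_chain {𝒳 𝒴 𝒜 ℬ : Type*} [Fintype 𝒳] [Fintype 𝒴] [Fintype 𝒜] [Fintype ℬ]
    (P : PMF Ω) (X : Ω → 𝒳) (Y : Ω → 𝒴) (A : Ω → 𝒜) (B : Ω → ℬ) :
    condEntropy P (fun ω => (A ω, X ω)) (fun ω => (B ω, Y ω)) + condEntropy P B Y =
      condEntropy P X Y + condEntropy P (fun ω => (A ω, B ω)) (fun ω => (X ω, Y ω)) := by
  have h1 := (hasSum_condEntropy P (fun ω => (A ω, X ω)) fun ω => (B ω, Y ω)).add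
    (hasSum_condEntropy P B Y)
  have h2 := (hasSum_condEntropy P X Y).add
    (hasSum_condEntropy P (fun ω => (A ω, B ω)) fun ω => (X ω, Y ω))
  rw [← add_mul] at h1 h2
  refine mul_right_cancel₀ (Real.log_pos one_lt_two).ne' (h1.unique ?_)
  -- Off the null points both sides telescope to the surprisal of (A, B, X) given Y.
  convert h2 using 2 with ω
  rcases eq_or_ne (P ω) 0 with h0 | hω
  · simp [h0]
  have e1 := pr_comp_injective P (fun ω => ((A ω, X ω), (B ω, Y ω)))
    (e := fun b => ((b.1.1, b.2.1), (b.1.2, b.2.2))) (fun a b h => by grind)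
    ((A ω, X ω), (B ω, Y ω))
  have p1 := pr_pos P (fun ω => ((A ω, X ω), (B ω, Y ω))) hω
  have p2 := pr_pos P (fun ω => (X ω, Y ω)) hω
  have p3 := pr_pos P (fun ω => (B ω, Y ω)) hω
  have p4 := pr_pos P Y hω
  simp only at e1
  rw [e1, Real.log_div (by positivity) (by positivity), Real.log_div (by positivity) (by positivity),
    Real.log_div (by positivity) (by positivity), Real.log_div (by positivity) (by positivity)]
  ring

end Information

/-! ### Runs of a protocol and their product form -/

namespace Protocol

variable {𝒳 𝒴 𝒜 ℬ : Type*}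

/-- The party whose turn it is has already halted. -/
def Stuck (Pi : Protocol 𝒳 𝒴 𝒜 ℬ) (s : Config 𝒜 ℬ) : Prop :=
  if (Even s.transcript.length ↔ Pi.aliceFirst = true) then s.outA ≠ none else s.outB ≠ none

lemma step_of_stuck (Pi : Protocol 𝒳 𝒴 𝒜 ℬ) (x : 𝒳) (y : 𝒴) {s : Config 𝒜 ℬ} (h : Pi.Stuck s) :
    Pi.step x y s = PMF.pure s := by
  unfold Stuck at h
  unfold step
  split_ifs at h ⊢
  · cases hs : s.outA with
    | none => exact absurd hs h
    | some a => rfl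
  · cases hs : s.outB with
    | none => exact absurd hs h
    | some b => rfl

lemma step_alice (Pi : Protocol 𝒳 𝒴 𝒜 ℬ) (x : 𝒳) (y : 𝒴) {m : Transcript} (ob : Option ℬ)
    (h : Even m.length ↔ Pi.aliceFirst = true) :
    Pi.step x y ⟨m, none, ob⟩ = (Pi.alice x m).map fun d => ⟨m ++ [d.1], d.2, ob⟩ := by
  simp only [step]
  rw [if_pos h]

lemma step_bob (Pi : Protocol 𝒳 𝒴 𝒜 ℬ) (x : 𝒳) (y : 𝒴) {m : Transcript} (oa : Option 𝒜)
    (h : ¬ (Even m.length ↔ Pi.aliceFirst = true)) :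
    Pi.step x y ⟨m, oa, none⟩ = (Pi.bob y m).map fun d => ⟨m ++ [d.1], oa, d.2⟩ := by
  simp only [step]
  rw [if_neg h]

lemma step_ne_zero (Pi : Protocol 𝒳 𝒴 𝒜 ℬ) (x : 𝒳) (y : 𝒴) {s s' : Config 𝒜 ℬ}
    (h : Pi.step x y s s' ≠ 0) :
    (Pi.Stuck s ∧ s' = s) ∨
    (¬ Pi.Stuck s ∧ (Even s.transcript.length ↔ Pi.aliceFirst = true) ∧ s.outA = none ∧
      s'.outB = s.outB ∧ ∃ d, s'.transcript = s.transcript ++ [d]) ∨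
    (¬ Pi.Stuck s ∧ ¬ (Even s.transcript.length ↔ Pi.aliceFirst = true) ∧ s.outB = none ∧
      s'.outA = s.outA ∧ ∃ d, s'.transcript = s.transcript ++ [d]) := by
  by_cases hs : Pi.Stuck s
  · rw [step_of_stuck Pi x y hs] at h
    left
    exact ⟨hs, by simpa using h⟩
  right
  obtain ⟨m, oa, ob⟩ := s
  by_cases ht : (Even m.length ↔ Pi.aliceFirst = true)
  · left
    have : oa = none := by simpa [Stuck, ht] using hs
    subst this
    rw [step_alice Pi x y ob ht, ← PMF.mem_support_iff, PMF.mem_support_map_iff] at h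
    obtain ⟨d, -, rfl⟩ := h
    exact ⟨hs, ht, rfl, rfl, d.1, rfl⟩
  · right
    have : ob = none := by simpa [Stuck, ht] using hs
    subst this
    rw [step_bob Pi x y oa ht, ← PMF.mem_support_iff, PMF.mem_support_map_iff] at h
    obtain ⟨d, -, rfl⟩ := h
    exact ⟨hs, ht, rfl, rfl, d.1, rfl⟩

/-- After `n` turns either `n` messages were sent, or the run is blocked. -/
lemma run_ne_zero (Pi : Protocol 𝒳 𝒴 𝒜 ℬ) (x : 𝒳) (y : 𝒴) (n : ℕ) {s : Config 𝒜 ℬ}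
    (h : Pi.run x y n s ≠ 0) :
    s.transcript.length = n ∨ (s.transcript.length < n ∧ Pi.Stuck s) := by
  induction n generalizing s with
  | zero =>
    left
    have : s = ⟨[], none, none⟩ := by simpa [run] using h
    simp [this]
  | succ n ih =>
    rw [run, ← PMF.mem_support_iff, PMF.mem_support_bind_iff] at h
    obtain ⟨s₀, h₀, h₁⟩ := h
    have i := ih ((PMF.mem_support_iff _ _).1 h₀)
    rcases step_ne_zero Pi x y ((PMF.mem_support_iff _ _).1 h₁) with
      ⟨hs, rfl⟩ | ⟨hs, -, -, -, d, hd⟩ | ⟨hs, -, -, -, d, hd⟩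
    · exact Or.inr ⟨by omega, hs⟩
    all_goals
      left
      rw [hd, List.length_append, List.length_singleton]
      rcases i with i | i
      · omega
      · exact absurd i.2 hs

lemma run_eq_zero_of_lt (Pi : Protocol 𝒳 𝒴 𝒜 ℬ) (x : 𝒳) (y : 𝒴) {n : ℕ} {s : Config 𝒜 ℬ}
    (h : n < s.transcript.length) : Pi.run x y n s = 0 := by
  by_contra h'
  have := Pi.run_ne_zero x y n h'
  omega

lemma stuck_of_final (Pi : Protocol 𝒳 𝒴 𝒜 ℬ) (m : Transcript) (a : 𝒜) (b : ℬ) :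
    Pi.Stuck ⟨m, some a, some b⟩ := by
  unfold Stuck
  split_ifs <;> simp

/-- Final configurations are stationary. -/
lemma run_succ_final (Pi : Protocol 𝒳 𝒴 𝒜 ℬ) (x : 𝒳) (y : 𝒴) {n : ℕ} {m : Transcript}
    (a : 𝒜) (b : ℬ) (h : m.length ≤ n) :
    Pi.run x y (n + 1) ⟨m, some a, some b⟩ = Pi.run x y n ⟨m, some a, some b⟩ := by
  rw [run, PMF.bind_apply, tsum_eq_single ⟨m, some a, some b⟩,
    step_of_stuck Pi x y (Pi.stuck_of_final m a b)]
  · simp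
  -- Any other predecessor would have just sent the last message of `m`, hence have a transcript
  -- shorter than `n`; by `run_ne_zero` it would be blocked and could not move.
  · intro s hs
    by_contra h'
    have h1 := left_ne_zero_of_mul h'
    have i := run_ne_zero Pi x y n h1
    rcases step_ne_zero Pi x y (right_ne_zero_of_mul h') with
      ⟨-, h2⟩ | ⟨h3, -, -, -, d, hd⟩ | ⟨h3, -, -, -, d, hd⟩
    · exact hs h2.symm
    all_goals
      have hl := congrArg List.length hd
      simp only [List.length_append, List.length_singleton] at hl
      rcases i with i | i
      · omega
      · exact h3 i.2

lemma run_final_of_le (Pi : Protocol 𝒳 𝒴 𝒜 ℬ) (x : 𝒳) (y : 𝒴) {n : ℕ} {m : Transcript}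
    (a : 𝒜) (b : ℬ) (h : m.length ≤ n) :
    Pi.run x y n ⟨m, some a, some b⟩ = Pi.run x y m.length ⟨m, some a, some b⟩ := by
  induction n, h using Nat.le_induction with
  | base => rfl
  | succ n hn ih => rw [run_succ_final Pi x y a b hn, ih]

/-- The supremum is attained at time `m.length`: the configuration is unreachable earlier and
stationary later. This makes induction on the transcript possible. -/
lemma finalProb_eq (Pi : Protocol 𝒳 𝒴 𝒜 ℬ) (x : 𝒳) (y : 𝒴) (a : 𝒜) (b : ℬ) (m : Transcript) :
    Pi.finalProb x y a b m = Pi.run x y m.length ⟨m, some a, some b⟩ := by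
  refine le_antisymm (iSup_le fun n => ?_)
    (le_iSup (fun n => Pi.run x y n ⟨m, some a, some b⟩) m.length)
  rcases lt_or_ge n m.length with h | h
  · rw [run_eq_zero_of_lt Pi x y (by exact h)]
    exact zero_le
  · exact (run_final_of_le Pi x y a b h).le

/-- The final configurations have total probability at most one. -/
lemma tsum_finalProb_le_one (Pi : Protocol 𝒳 𝒴 𝒜 ℬ) (x : 𝒳) (y : 𝒴) :
    ∑' t : 𝒜 × ℬ × Transcript, Pi.finalProb x y t.1 t.2.1 t.2.2 ≤ 1 := by
  rw [ENNReal.tsum_eq_iSup_sum]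
  refine iSup_le fun F => ?_
  -- By time `N` every final configuration in the finite set has its limiting probability, so all of
  -- them are events of the single law of the run at time `N`.
  set N := F.sup fun t => t.2.2.length with hN
  set e : 𝒜 × ℬ × Transcript → Config 𝒜 ℬ := fun t => ⟨t.2.2, some t.1, some t.2.1⟩ with he
  have hinj : Function.Injective e := fun s t h => by
    simp only [he, Config.mk.injEq, Option.some.injEq] at h
    grind
  calc ∑ t ∈ F, Pi.finalProb x y t.1 t.2.1 t.2.2 = ∑ t ∈ F, Pi.run x y N (e t) := by
        refine Finset.sum_congr rfl fun t ht => ?_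
        rw [finalProb_eq, run_final_of_le Pi x y t.1 t.2.1 (n := N)]
        exact Finset.le_sup (f := fun t : 𝒜 × ℬ × Transcript => t.2.2.length) ht
    _ ≤ ∑' t, Pi.run x y N (e t) := ENNReal.sum_le_tsum F
    _ ≤ ∑' s, Pi.run x y N s := ENNReal.tsum_comp_le_tsum_of_injective hinj _
    _ = 1 := PMF.tsum_coe _

/-- After `m.length + 1` turns a transcript of that length means that every turn sent a message. The
predecessor therefore has transcript `m`, and Alice, who moved last, had no output yet. -/
lemma run_append_alice (Pi : Protocol 𝒳 𝒴 𝒜 ℬ) (x : 𝒳) (y : 𝒴) (m : Transcript) (d : List Bool)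
    (oa : Option 𝒜) (ob : Option ℬ) (h : Even m.length ↔ Pi.aliceFirst = true) :
    Pi.run x y (m.length + 1) ⟨m ++ [d], oa, ob⟩ =
      Pi.run x y m.length ⟨m, none, ob⟩ * Pi.alice x m (d, oa) := by
  classical
  rw [run, PMF.bind_apply, tsum_eq_single ⟨m, none, ob⟩, step_alice Pi x y ob h, PMF.map_apply,
    tsum_eq_single (d, oa)]
  · simp
  · rintro ⟨d', oa'⟩ hne
    rw [if_neg]
    simp only [Config.mk.injEq, List.append_cancel_left_eq, List.cons.injEq, and_true]
    grind
  · rintro ⟨m', oa', ob'⟩ hne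
    by_contra h'
    rcases step_ne_zero Pi x y (right_ne_zero_of_mul h') with
      ⟨-, h2⟩ | ⟨-, ht, h2, h3, d', hd⟩ | ⟨-, ht, h2, h3, d', hd⟩
    · rw [← h2] at h'
      exact left_ne_zero_of_mul h' (run_eq_zero_of_lt Pi x y (by simp))
    · obtain ⟨rfl, -⟩ := List.append_inj' hd rfl
      exact hne (by simp_all)
    · obtain ⟨rfl, -⟩ := List.append_inj' hd rfl
      exact ht h

lemma run_append_bob (Pi : Protocol 𝒳 𝒴 𝒜 ℬ) (x : 𝒳) (y : 𝒴) (m : Transcript) (d : List Bool)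
    (oa : Option 𝒜) (ob : Option ℬ) (h : ¬ (Even m.length ↔ Pi.aliceFirst = true)) :
    Pi.run x y (m.length + 1) ⟨m ++ [d], oa, ob⟩ =
      Pi.run x y m.length ⟨m, oa, none⟩ * Pi.bob y m (d, ob) := by
  classical
  rw [run, PMF.bind_apply, tsum_eq_single ⟨m, oa, none⟩, step_bob Pi x y oa h, PMF.map_apply,
    tsum_eq_single (d, ob)]
  · simp
  · rintro ⟨d', ob'⟩ hne
    rw [if_neg]
    simp only [Config.mk.injEq, List.append_cancel_left_eq, List.cons.injEq, and_true]
    grind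
  · rintro ⟨m', oa', ob'⟩ hne
    by_contra h'
    rcases step_ne_zero Pi x y (right_ne_zero_of_mul h') with
      ⟨-, h2⟩ | ⟨-, ht, h2, h3, d', hd⟩ | ⟨-, ht, h2, h3, d', hd⟩
    · rw [← h2] at h'
      exact left_ne_zero_of_mul h' (run_eq_zero_of_lt Pi x y (by simp))
    · obtain ⟨rfl, -⟩ := List.append_inj' hd rfl
      exact h ht
    · obtain ⟨rfl, -⟩ := List.append_inj' hd rfl
      exact hne (by simp_all)

/-- Private coins: the probability of a configuration is a product of a term that depends only on
Alice's data and one that depends only on Bob's. -/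
lemma exists_run_eq_mul (Pi : Protocol 𝒳 𝒴 𝒜 ℬ) (m : Transcript) :
    ∃ (f : 𝒳 → Option 𝒜 → ℝ≥0∞) (g : 𝒴 → Option ℬ → ℝ≥0∞),
      (∀ x oa, f x oa ≠ ⊤) ∧ (∀ y ob, g y ob ≠ ⊤) ∧
      ∀ x y oa ob, Pi.run x y m.length ⟨m, oa, ob⟩ = f x oa * g y ob := by
  classical
  induction m using List.reverseRecOn with
  | nil =>
    refine ⟨fun _ oa => if oa = none then 1 else 0, fun _ ob => if ob = none then 1 else 0,
      fun _ oa => by dsimp only; split_ifs <;> simp, fun _ ob => by dsimp only; split_ifs <;> simp,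
      fun x y oa ob => ?_⟩
    cases oa <;> cases ob <;> simp [run, PMF.pure_apply]
  | append_singleton m d ih =>
    obtain ⟨f, g, hf, hg, hfg⟩ := ih
    simp only [List.length_append, List.length_singleton]
    by_cases h : (Even m.length ↔ Pi.aliceFirst = true)
    -- Only the mover's factor changes; it is taken at `none`, as the mover had not halted before
    -- this message.
    · refine ⟨fun x oa => f x none * Pi.alice x m (d, oa), g,
        fun x oa => ENNReal.mul_ne_top (hf _ _) (PMF.apply_ne_top _ _), hg, fun x y oa ob => ?_⟩
      rw [run_append_alice Pi x y m d oa ob h, hfg]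
      ring
    · refine ⟨f, fun y ob => g y none * Pi.bob y m (d, ob), hf,
        fun y ob => ENNReal.mul_ne_top (hg _ _) (PMF.apply_ne_top _ _), fun x y oa ob => ?_⟩
      rw [run_append_bob Pi x y m d oa ob h, hfg]
      ring

lemma exists_finalProb_eq_mul (Pi : Protocol 𝒳 𝒴 𝒜 ℬ) :
    ∃ (f : 𝒳 → 𝒜 → Transcript → ℝ≥0∞) (g : 𝒴 → ℬ → Transcript → ℝ≥0∞),
      (∀ x a m, f x a m ≠ ⊤) ∧ (∀ y b m, g y b m ≠ ⊤) ∧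
      ∀ x y a b m, Pi.finalProb x y a b m = f x a m * g y b m := by
  choose f g hf hg h using Pi.exists_run_eq_mul
  exact ⟨fun x a m => f m x (some a), fun y b m => g m y (some b), fun x a m => hf m x _,
    fun y b m => hg m y _, fun x y a b m => by rw [finalProb_eq, h]⟩

end Protocol

/-! ### Information inequalities for laws of product form -/

section Factorization

variable {Ω 𝒳 𝒴 𝒜 ℬ ℳ κ : Type*}

/-- Given `(X, Y)`, the variable `Q` is independent of `(A, B, M)`, and the conditional law of
`(A, B, M)` is a product of a term in Alice's data and a term in Bob's data, of total mass at most
one for every pair of inputs. -/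
structure Factors (P : PMF Ω) (X : Ω → 𝒳) (Y : Ω → 𝒴) (A : Ω → 𝒜) (B : Ω → ℬ) (M : Ω → ℳ)
    (Q : Ω → κ) (f : 𝒳 → 𝒜 → ℳ → ℝ≥0∞) (g : 𝒴 → ℬ → ℳ → ℝ≥0∞) : Prop where
  joint : ∀ x y a b m q, P.map (fun ω => (X ω, Y ω, A ω, B ω, M ω, Q ω)) (x, y, a, b, m, q) =
    P.map (fun ω => (X ω, Y ω, Q ω)) (x, y, q) * (f x a m * g y b m)
  left_ne_top : ∀ x a m, f x a m ≠ ⊤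
  right_ne_top : ∀ y b m, g y b m ≠ ⊤
  tsum_le : ∀ x y, ∑' (m) (a) (b), f x a m * g y b m ≤ 1

variable {P : PMF Ω} {X : Ω → 𝒳} {Y : Ω → 𝒴} {A : Ω → 𝒜} {B : Ω → ℬ} {M : Ω → ℳ} {Q : Ω → κ}
  {f : 𝒳 → 𝒜 → ℳ → ℝ≥0∞} {g : 𝒴 → ℬ → ℳ → ℝ≥0∞}

namespace Factors

lemma symm (h : Factors P X Y A B M Q f g) : Factors P Y X B A M Q g f where
  joint y x b a m q := by
    have h1 := map_comp_injective P (fun ω => (X ω, Y ω, A ω, B ω, M ω, Q ω))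
      (e := fun t => (t.2.1, t.1, t.2.2.2.1, t.2.2.1, t.2.2.2.2)) (fun s t h => by grind)
      (x, y, a, b, m, q)
    have h2 := map_comp_injective P (fun ω => (X ω, Y ω, Q ω))
      (e := fun t => (t.2.1, t.1, t.2.2)) (fun s t h => by grind) (x, y, q)
    simp only at h1 h2
    rw [h1, h2, h.joint, mul_comm (g y b m)]
  left_ne_top := h.right_ne_top
  right_ne_top := h.left_ne_top
  tsum_le y x := by
    refine le_of_eq_of_le (tsum_congr fun m => ?_) (h.tsum_le x y)
    rw [ENNReal.tsum_comm]
    simp only [mul_comm]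

/-- The law of `(X, M, Y)` is the law of `(X, Y)` times a product. -/
lemma map_transcript (h : Factors P X Y A B M Q f g) (x : 𝒳) (y : 𝒴) (m : ℳ) :
    P.map (fun ω => (X ω, M ω, Y ω)) (x, m, y) =
      P.map (fun ω => (X ω, Y ω)) (x, y) * ((∑' a, f x a m) * ∑' b, g y b m) := by
  have h1 := map_comp_injective P (fun ω => (X ω, Y ω, M ω))
      (e := fun t => (t.1, t.2.2, t.2.1)) (fun s t h => by grind) (x, y, m)
  have h2 : ∀ a b q, P.map (fun ω => ((X ω, Y ω, M ω), (A ω, B ω, Q ω))) ((x, y, m), (a, b, q)) =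
      P.map (fun ω => ((X ω, Y ω), Q ω)) ((x, y), q) * (f x a m * g y b m) := fun a b q => by
    have h3 := map_comp_injective P (fun ω => (X ω, Y ω, A ω, B ω, M ω, Q ω))
      (e := fun t => ((t.1, t.2.1, t.2.2.2.2.1), (t.2.2.1, t.2.2.2.1, t.2.2.2.2.2)))
      (fun s t h => by grind) (x, y, a, b, m, q)
    have h4 := map_comp_injective P (fun ω => (X ω, Y ω, Q ω))
      (e := fun t => ((t.1, t.2.1), t.2.2)) (fun s t h => by grind) (x, y, q)
    simp only at h3 h4
    rw [h3, h4, h.joint]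
  simp only at h1
  rw [h1, ← tsum_map_prod P (fun ω => (X ω, Y ω, M ω)) fun ω => (A ω, B ω, Q ω)]
  simp only [ENNReal.tsum_prod', h2, ENNReal.tsum_mul_right, ENNReal.tsum_mul_left,
    tsum_map_prod P (fun ω => (X ω, Y ω)) Q]

/-- `H(X | M, Y) + H(X | Q, Y) ≤ H(X | Y) + H(A, X | Q, M, B, Y)`. -/
lemma condEntropy_add_le [Fintype 𝒳] [Fintype 𝒜] [Fintype ℬ] (h : Factors P X Y A B M Q f g) :
    condEntropy P X (fun ω => (M ω, Y ω)) + condEntropy P X (fun ω => (Q ω, Y ω)) ≤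
      condEntropy P X Y +
        condEntropy P (fun ω => (A ω, X ω)) (fun ω => ((Q ω, M ω), (B ω, Y ω))) := by
  have h1 := ((hasSum_condEntropy P X fun ω => (M ω, Y ω)).add
    (hasSum_condEntropy P X fun ω => (Q ω, Y ω))).sub ((hasSum_condEntropy P X Y).add
    (hasSum_condEntropy P (fun ω => (A ω, X ω)) fun ω => ((Q ω, M ω), (B ω, Y ω))))
  simp only [← mul_add, ← mul_sub] at h1
  rw [← add_mul, ← add_mul, ← sub_mul] at h1
  -- The comparison law of (Y, Q, M, B) makes Q and M independent given Y, and then draws B from the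
  -- normalized `g`. Summing over B, then M, then Q bounds its mass by one.
  refine sub_nonpos.1 (nonpos_of_mul_nonpos_left (nonpos_of_hasSum P h1
    (fun ω => P.map (fun ω => (M ω, Y ω)) (M ω, Y ω) * (P.map (fun ω => (Q ω, Y ω)) (Q ω, Y ω) /
      P.map Y (Y ω) * (g (Y ω) (B ω) (M ω) / ∑' b, g (Y ω) b (M ω))) /
      P.map (fun ω => (Y ω, Q ω, M ω, B ω)) (Y ω, Q ω, M ω, B ω)) 1 ?_ fun ω hω => ?_)
      (Real.log_pos one_lt_two))
  · refine (tsum_div_map_le P (fun ω => (Y ω, Q ω, M ω, B ω)) fun t =>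
      P.map (fun ω => (M ω, Y ω)) (t.2.2.1, t.1) * (P.map (fun ω => (Q ω, Y ω)) (t.2.1, t.1) /
      P.map Y t.1 * (g t.1 t.2.2.2 t.2.2.1 / ∑' b, g t.1 b t.2.2.1))).trans ?_
    simp only [ENNReal.tsum_prod', ENNReal.tsum_mul_left]
    calc _ ≤ ∑' (y) (q) (m), P.map (fun ω => (M ω, Y ω)) (m, y) *
          (P.map (fun ω => (Q ω, Y ω)) (q, y) / P.map Y y) := by
            gcongr with y q m
            exact mul_le_of_le_one_right' (tsum_div_const_le_one _)
      _ = ∑' y, P.map Y y * (P.map Y y / P.map Y y) := by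
            simp only [ENNReal.tsum_mul_left, ENNReal.tsum_mul_right, div_eq_mul_inv,
              tsum_map_prod_left]
      _ ≤ ∑' y, P.map Y y := by
            gcongr with y
            exact mul_le_of_le_one_right' ENNReal.div_self_le_one
      _ = ((1 : ℕ) : ℝ≥0∞) := by rw [PMF.tsum_coe, Nat.cast_one]
  · have e1 := pr_comp_injective P (fun ω => (Y ω, Q ω, M ω, B ω))
      (e := fun t => ((t.2.1, t.2.2.1), (t.2.2.2, t.1))) (fun s t h => by grind)
      (Y ω, Q ω, M ω, B ω)
    have e2 := map_comp_injective P (fun ω => (X ω, Y ω, A ω, B ω, M ω, Q ω))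
      (e := fun t => ((t.2.2.1, t.1), ((t.2.2.2.2.2, t.2.2.2.2.1), (t.2.2.2.1, t.2.1))))
      (fun s t h => by grind) (X ω, Y ω, A ω, B ω, M ω, Q ω)
    have e3 := map_comp_injective P (fun ω => (X ω, Y ω, Q ω))
      (e := fun t => (t.1, t.2.2, t.2.1)) (fun s t h => by grind) (X ω, Y ω, Q ω)
    simp only at e1 e2 e3
    rw [h.joint, ← e3] at e2
    have n1 := map_apply_ne_zero P (fun ω => ((A ω, X ω), ((Q ω, M ω), (B ω, Y ω)))) hω
    have n2 : f (X ω) (A ω) (M ω) ≠ 0 := fun h0 => n1 (by simp [e2, h0])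
    have n3 : g (Y ω) (B ω) (M ω) ≠ 0 := fun h0 => n1 (by simp [e2, h0])
    have hf : f (X ω) (A ω) (M ω) ≤ ∑' a, f (X ω) a (M ω) :=
      ENNReal.le_tsum (f := fun a => f (X ω) a (M ω)) (A ω)
    have hg : g (Y ω) (B ω) (M ω) ≤ ∑' b, g (Y ω) b (M ω) :=
      ENNReal.le_tsum (f := fun b => g (Y ω) b (M ω)) (B ω)
    have tf : ∑' a, f (X ω) a (M ω) ≠ ⊤ := by
      rw [tsum_fintype]
      exact ENNReal.sum_ne_top.2 fun a _ => h.left_ne_top _ _ _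
    have tg : ∑' b, g (Y ω) b (M ω) ≠ ⊤ := by
      rw [tsum_fintype]
      exact ENNReal.sum_ne_top.2 fun a _ => h.right_ne_top _ _ _
    have f0 := ENNReal.toReal_pos n2 (h.left_ne_top _ _ _)
    have g0 := ENNReal.toReal_pos n3 (h.right_ne_top _ _ _)
    have hf' := ENNReal.toReal_mono tf hf
    have hg' := ENNReal.toReal_mono tg hg
    have sg0 := g0.trans_le hg'
    have sf0 := f0.trans_le hf'
    have r1 := congrArg ENNReal.toReal (h.map_transcript (X ω) (Y ω) (M ω))
    have r2 := congrArg ENNReal.toReal e2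
    simp only [ENNReal.toReal_mul] at r1 r2
    change pr P (fun ω => (X ω, M ω, Y ω)) (X ω, M ω, Y ω) =
      pr P (fun ω => (X ω, Y ω)) (X ω, Y ω) * _ at r1
    change pr P (fun ω => ((A ω, X ω), ((Q ω, M ω), (B ω, Y ω))))
      ((A ω, X ω), ((Q ω, M ω), (B ω, Y ω))) =
      pr P (fun ω => (X ω, Q ω, Y ω)) (X ω, Q ω, Y ω) * _ at r2
    simp only [ENNReal.toReal_div, ENNReal.toReal_mul, Nat.cast_one]
    change _ ≤ pr P (fun ω => (M ω, Y ω)) (M ω, Y ω) * (pr P (fun ω => (Q ω, Y ω)) (Q ω, Y ω) /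
      pr P Y (Y ω) * _) / pr P (fun ω => (Y ω, Q ω, M ω, B ω)) (Y ω, Q ω, M ω, B ω) - 1
    have p1 := pr_pos P (fun ω => (M ω, Y ω)) hω
    have p2 := pr_pos P (fun ω => (Q ω, Y ω)) hω
    have p3 := pr_pos P Y hω
    have p4 := pr_pos P (fun ω => (X ω, Y ω)) hω
    have p5 := pr_pos P (fun ω => (X ω, Q ω, Y ω)) hω
    have p6 := pr_pos P (fun ω => (Y ω, Q ω, M ω, B ω)) hω
    rw [e1, r1, r2]
    generalize pr P (fun ω => (M ω, Y ω)) (M ω, Y ω) = my at *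
    generalize pr P (fun ω => (Q ω, Y ω)) (Q ω, Y ω) = qy at *
    generalize pr P Y (Y ω) = py at *
    generalize pr P (fun ω => (X ω, Y ω)) (X ω, Y ω) = xy at *
    generalize pr P (fun ω => (X ω, Q ω, Y ω)) (X ω, Q ω, Y ω) = xqy at *
    generalize pr P (fun ω => (Y ω, Q ω, M ω, B ω)) (Y ω, Q ω, M ω, B ω) = yqmb at *
    generalize (f (X ω) (A ω) (M ω)).toReal = u at *
    generalize (g (Y ω) (B ω) (M ω)).toReal = v at *
    generalize (∑' a, f (X ω) a (M ω)).toReal = su at *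
    generalize (∑' b, g (Y ω) b (M ω)).toReal = sv at *
    -- The bound f ≤ ∑ f discards the surprisal of A given (X, M); the remaining terms are exactly
    -- log Z.
    have l1 := Real.log_le_log f0 hf'
    have l2 := Real.log_le_sub_one_of_pos (x := my * (qy / py * (v / sv)) / yqmb) (by positivity)
    rw [Real.log_div (by positivity) (by positivity), Real.log_mul (by positivity) (by positivity),
      Real.log_mul (by positivity) (by positivity), Real.log_div (by positivity) (by positivity),
      Real.log_div (by positivity) (by positivity)] at l2
    rw [Real.log_div (by positivity) (by positivity), Real.log_div (by positivity) (by positivity),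
      Real.log_div (by positivity) (by positivity), Real.log_div (by positivity) (by positivity),
      Real.log_mul (by positivity) (by positivity), Real.log_mul (by positivity) (by positivity),
      Real.log_mul (by positivity) (by positivity), Real.log_mul (by positivity) (by positivity)]
    linarith

end Factors

/-- The mass of `(Q, M) = (q, m)` under the product of the law of `(X, Q)` and `f`. -/
noncomputable def sideMass (P : PMF Ω) (X : Ω → 𝒳) (Q : Ω → κ) (f : 𝒳 → 𝒜 → ℳ → ℝ≥0∞)
    (q : κ) (m : ℳ) : ℝ≥0∞ :=
  ∑' (x) (a), P.map (fun ω => (X ω, Q ω)) (x, q) * f x a m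

/-- For fixed (q, m), normalizing by `sideMass` turns the weight into a sub-probability on (a, x).
This is one party's share of the Gibbs bound in `Factors.condMutualInfo_le`; it is applied to Alice
and to Bob. -/
lemma tsum_side_le_one (P : PMF Ω) (X : Ω → 𝒳) (A : Ω → 𝒜) (M : Ω → ℳ) (Q : Ω → κ)
    (f : 𝒳 → 𝒜 → ℳ → ℝ≥0∞) :
    ∑' ω, P ω * (P.map (fun ω => (Q ω, M ω)) (Q ω, M ω) * (P.map (fun ω => (X ω, Q ω)) (X ω, Q ω) *
      f (X ω) (A ω) (M ω) / sideMass P X Q f (Q ω) (M ω)) /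
      P.map (fun ω => ((A ω, X ω), (Q ω, M ω))) ((A ω, X ω), (Q ω, M ω))) ≤ 1 := by
  refine (tsum_div_map_le P (fun ω => ((A ω, X ω), (Q ω, M ω))) fun t =>
    P.map (fun ω => (Q ω, M ω)) t.2 * (P.map (fun ω => (X ω, Q ω)) (t.1.2, t.2.1) *
      f t.1.2 t.1.1 t.2.2 / sideMass P X Q f t.2.1 t.2.2)).trans ?_
  rw [ENNReal.tsum_prod', ENNReal.tsum_comm, ← PMF.tsum_coe (P.map fun ω => (Q ω, M ω))]
  refine ENNReal.tsum_le_tsum fun t => ?_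
  dsimp only
  rw [ENNReal.tsum_mul_left]
  refine mul_le_of_le_one_right' ?_
  rw [ENNReal.tsum_prod', ENNReal.tsum_comm]
  simp only [div_eq_mul_inv, ENNReal.tsum_mul_right]
  exact ENNReal.div_self_le_one

lemma sideMass_toReal_pos [Fintype 𝒳] [Fintype 𝒜] (P : PMF Ω) (X : Ω → 𝒳) (Q : Ω → κ)
    {f : 𝒳 → 𝒜 → ℳ → ℝ≥0∞} (hf : ∀ x a m, f x a m ≠ ⊤) {ω : Ω} (hω : P ω ≠ 0) {a : 𝒜} {m : ℳ}
    (h0 : f (X ω) a m ≠ 0) : 0 < (sideMass P X Q f (Q ω) m).toReal := by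
  refine ENNReal.toReal_pos ?_ ?_
  · intro h
    simp only [sideMass, ENNReal.tsum_eq_zero] at h
    exact mul_ne_zero (map_apply_ne_zero P (fun ω => (X ω, Q ω)) hω) h0 (h _ _)
  · simp only [sideMass, tsum_fintype]
    exact ENNReal.sum_ne_top.2 fun x _ => ENNReal.sum_ne_top.2 fun a _ =>
      ENNReal.mul_ne_top (PMF.apply_ne_top _ _) (hf _ _ _)

namespace Factors

/-- The product of the two side masses over P[Q = q] is the mass of (q, m) when the kernel f g is
applied to inputs made independent given Q. -/
lemma tsum_sideMass_le_one (h : Factors P X Y A B M Q f g) :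
    ∑' ω, P ω * (sideMass P X Q f (Q ω) (M ω) * sideMass P Y Q g (Q ω) (M ω) / P.map Q (Q ω) /
      P.map (fun ω => (Q ω, M ω)) (Q ω, M ω)) ≤ 1 := by
  refine (tsum_div_map_le P (fun ω => (Q ω, M ω)) fun t =>
    sideMass P X Q f t.1 t.2 * sideMass P Y Q g t.1 t.2 / P.map Q t.1).trans ?_
  rw [ENNReal.tsum_prod', ← PMF.tsum_coe (P.map Q)]
  refine ENNReal.tsum_le_tsum fun q => ?_
  simp only [div_eq_mul_inv, ENNReal.tsum_mul_right]
  rw [← div_eq_mul_inv]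
  refine ENNReal.div_le_of_le_mul ?_
  calc ∑' m, sideMass P X Q f q m * sideMass P Y Q g q m
      = ∑' (x) (y), P.map (fun ω => (X ω, Q ω)) (x, q) * P.map (fun ω => (Y ω, Q ω)) (y, q) *
          ∑' (m) (a) (b), f x a m * g y b m := by
        have : ∀ m, sideMass P X Q f q m * sideMass P Y Q g q m = ∑' (x) (y),
            P.map (fun ω => (X ω, Q ω)) (x, q) * P.map (fun ω => (Y ω, Q ω)) (y, q) *
              ∑' (a) (b), f x a m * g y b m := fun m => by
          simp only [sideMass, ENNReal.tsum_mul_left, ENNReal.tsum_mul_right]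
          rw [← ENNReal.tsum_mul_right]
          refine tsum_congr fun x => ?_
          rw [← ENNReal.tsum_mul_left]
          exact tsum_congr fun y => by ring
        simp only [this]
        rw [ENNReal.tsum_comm]
        refine tsum_congr fun x => ?_
        rw [ENNReal.tsum_comm]
        exact tsum_congr fun y => ENNReal.tsum_mul_left
    _ ≤ ∑' (x) (y), P.map (fun ω => (X ω, Q ω)) (x, q) * P.map (fun ω => (Y ω, Q ω)) (y, q) := by
        refine ENNReal.tsum_le_tsum fun x => ENNReal.tsum_le_tsum fun y => ?_
        -- The comparison law may charge input pairs that (X, Y) never takes, where the run need not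
        -- finish. Hence mass at most one is required for every pair, and it suffices.
        exact mul_le_of_le_one_right' (h.tsum_le x y)
    _ = P.map Q q * P.map Q q := by
        simp only [ENNReal.tsum_mul_left, ENNReal.tsum_mul_right, tsum_map_prod_left]

/-- `I(B, Y ; A, X | Q, M) ≤ I(Y ; X | Q)`. -/
lemma condMutualInfo_le [Fintype 𝒳] [Fintype 𝒴] [Fintype 𝒜] [Fintype ℬ]
    (h : Factors P X Y A B M Q f g) :
    condMutualInfo P (fun ω => (B ω, Y ω)) (fun ω => (A ω, X ω)) (fun ω => (Q ω, M ω)) ≤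
      condMutualInfo P Y X Q := by
  have h1 := ((hasSum_condEntropy P (fun ω => (B ω, Y ω)) fun ω => (Q ω, M ω)).sub
    (hasSum_condEntropy P (fun ω => (B ω, Y ω)) fun ω => ((A ω, X ω), (Q ω, M ω)))).sub
    ((hasSum_condEntropy P Y Q).sub (hasSum_condEntropy P Y fun ω => (X ω, Q ω)))
  simp only [← mul_sub] at h1
  rw [← sub_mul, ← sub_mul, ← sub_mul] at h1
  -- The integrand is the sum of three logarithms, one for each nonnegative divergence: (A, X) given
  -- (Q, M), (B, Y) given (Q, M), and (Q, M) itself. Each ratio has expectation at most one, whence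
  -- the constant 3.
  refine sub_nonpos.1 (nonpos_of_mul_nonpos_left (nonpos_of_hasSum P h1 (fun ω =>
    P.map (fun ω => (Q ω, M ω)) (Q ω, M ω) * (P.map (fun ω => (X ω, Q ω)) (X ω, Q ω) *
      f (X ω) (A ω) (M ω) / sideMass P X Q f (Q ω) (M ω)) /
      P.map (fun ω => ((A ω, X ω), (Q ω, M ω))) ((A ω, X ω), (Q ω, M ω)) +
    P.map (fun ω => (Q ω, M ω)) (Q ω, M ω) * (P.map (fun ω => (Y ω, Q ω)) (Y ω, Q ω) *
      g (Y ω) (B ω) (M ω) / sideMass P Y Q g (Q ω) (M ω)) /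
      P.map (fun ω => ((B ω, Y ω), (Q ω, M ω))) ((B ω, Y ω), (Q ω, M ω)) +
    sideMass P X Q f (Q ω) (M ω) * sideMass P Y Q g (Q ω) (M ω) / P.map Q (Q ω) /
      P.map (fun ω => (Q ω, M ω)) (Q ω, M ω)) 3 ?_ fun ω hω => ?_)
      (Real.log_pos one_lt_two))
  · simp only [mul_add, ENNReal.tsum_add]
    refine (add_le_add (add_le_add (tsum_side_le_one P X A M Q f) (tsum_side_le_one P Y B M Q g))
      h.tsum_sideMass_le_one).trans_eq ?_
    norm_num
  · have e2 := map_comp_injective P (fun ω => (X ω, Y ω, A ω, B ω, M ω, Q ω))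
      (e := fun t => ((t.2.2.2.1, t.2.1), ((t.2.2.1, t.1), (t.2.2.2.2.2, t.2.2.2.2.1))))
      (fun s t h => by grind) (X ω, Y ω, A ω, B ω, M ω, Q ω)
    have e3 := map_comp_injective P (fun ω => (X ω, Y ω, Q ω))
      (e := fun t => (t.2.1, t.1, t.2.2)) (fun s t h => by grind) (X ω, Y ω, Q ω)
    simp only at e2 e3
    rw [h.joint, ← e3] at e2
    have n1 := map_apply_ne_zero P (fun ω => ((B ω, Y ω), ((A ω, X ω), (Q ω, M ω)))) hω
    have n2 : f (X ω) (A ω) (M ω) ≠ 0 := fun h0 => n1 (by simp [e2, h0])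
    have n3 : g (Y ω) (B ω) (M ω) ≠ 0 := fun h0 => n1 (by simp [e2, h0])
    have f0 := ENNReal.toReal_pos n2 (h.left_ne_top _ _ _)
    have g0 := ENNReal.toReal_pos n3 (h.right_ne_top _ _ _)
    have s0 := sideMass_toReal_pos P X Q h.left_ne_top hω n2
    have t0 := sideMass_toReal_pos P Y Q h.right_ne_top hω n3
    have r2 := congrArg ENNReal.toReal e2
    simp only [ENNReal.toReal_mul] at r2
    change pr P (fun ω => ((B ω, Y ω), ((A ω, X ω), (Q ω, M ω))))
      ((B ω, Y ω), ((A ω, X ω), (Q ω, M ω))) =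
      pr P (fun ω => (Y ω, X ω, Q ω)) (Y ω, X ω, Q ω) * _ at r2
    have p1 := pr_pos P (fun ω => (Q ω, M ω)) hω
    have p2 := pr_pos P (fun ω => (X ω, Q ω)) hω
    have p3 := pr_pos P Q hω
    have p4 := pr_pos P (fun ω => (Y ω, Q ω)) hω
    have p5 := pr_pos P (fun ω => (Y ω, X ω, Q ω)) hω
    have p6 := pr_pos P (fun ω => ((A ω, X ω), (Q ω, M ω))) hω
    have p7 := pr_pos P (fun ω => ((B ω, Y ω), (Q ω, M ω))) hω
    have k : ∀ {a b c : ℝ≥0∞}, 0 < a.toReal → 0 < b.toReal → 0 < c.toReal →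
        (a + b + c).toReal = a.toReal + b.toReal + c.toReal := fun ha hb hc => by
      have ha' := (ENNReal.toReal_pos_iff.1 ha).2.ne
      have hb' := (ENNReal.toReal_pos_iff.1 hb).2.ne
      rw [ENNReal.toReal_add (ENNReal.add_ne_top.2 ⟨ha', hb'⟩) (ENNReal.toReal_pos_iff.1 hc).2.ne,
        ENNReal.toReal_add ha' hb']
    unfold pr at p1 p2 p3 p4 p5 p6 p7 r2 ⊢
    rw [k (by simp only [ENNReal.toReal_div, ENNReal.toReal_mul]; positivity)
      (by simp only [ENNReal.toReal_div, ENNReal.toReal_mul]; positivity)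
      (by simp only [ENNReal.toReal_div, ENNReal.toReal_mul]; positivity)]
    simp only [ENNReal.toReal_div, ENNReal.toReal_mul]
    rw [r2]
    generalize (P.map (fun ω => (Q ω, M ω)) (Q ω, M ω)).toReal = qm at *
    generalize (P.map (fun ω => (X ω, Q ω)) (X ω, Q ω)).toReal = xq at *
    generalize (P.map Q (Q ω)).toReal = pq at *
    generalize (P.map (fun ω => (Y ω, Q ω)) (Y ω, Q ω)).toReal = yq at *
    generalize (P.map (fun ω => (Y ω, X ω, Q ω)) (Y ω, X ω, Q ω)).toReal = yxq at *
    generalize (P.map (fun ω => ((A ω, X ω), (Q ω, M ω))) ((A ω, X ω), (Q ω, M ω))).toReal = axqm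
      at *
    generalize (P.map (fun ω => ((B ω, Y ω), (Q ω, M ω))) ((B ω, Y ω), (Q ω, M ω))).toReal = byqm
      at *
    generalize (f (X ω) (A ω) (M ω)).toReal = u at *
    generalize (g (Y ω) (B ω) (M ω)).toReal = v at *
    generalize (sideMass P X Q f (Q ω) (M ω)).toReal = s at *
    generalize (sideMass P Y Q g (Q ω) (M ω)).toReal = t at *
    have l1 := Real.log_le_sub_one_of_pos (x := qm * (xq * u / s) / axqm) (by positivity)
    have l2 := Real.log_le_sub_one_of_pos (x := qm * (yq * v / t) / byqm) (by positivity)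
    have l3 := Real.log_le_sub_one_of_pos (x := s * t / pq / qm) (by positivity)
    rw [Real.log_div (by positivity) (by positivity), Real.log_mul (by positivity) (by positivity),
      Real.log_div (by positivity) (by positivity), Real.log_mul (by positivity) (by positivity)]
      at l1 l2
    rw [Real.log_div (by positivity) (by positivity), Real.log_div (by positivity) (by positivity),
      Real.log_mul (by positivity) (by positivity)] at l3
    rw [Real.log_div (by positivity) (by positivity), Real.log_div (by positivity) (by positivity),
      Real.log_div (by positivity) (by positivity), Real.log_div (by positivity) (by positivity),
      Real.log_mul (by positivity) (by positivity), Real.log_mul (by positivity) (by positivity)]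
    push_cast
    linarith

/-- `H(B | Y) - H(A, B | X, Y) ≤ I(X ; M | Y)`. -/
lemma condEntropy_sub_le [Fintype 𝒳] [Fintype 𝒴] [Fintype 𝒜] [Fintype ℬ]
    (h : Factors P X Y A B M (fun _ => ()) f g) :
    condEntropy P B Y - condEntropy P (fun ω => (A ω, B ω)) (fun ω => (X ω, Y ω)) ≤
      condMutualInfo P X M Y := by
  -- With constant Q, the term H(X | Q, Y) cancels H(X | Y).
  have h1 := h.condEntropy_add_le
  have h2 := condEntropy_chain P X Y A B
  have h3 := condEntropy_prod_le P (fun ω => (A ω, X ω)) (fun ω => ((), M ω)) fun ω => (B ω, Y ω)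
  have h4 := condEntropy_comp_injective P X Y (d := id) Function.injective_id
    (e := fun y => ((), y)) (fun s t h => by grind)
  simp only [id] at h4
  unfold condMutualInfo
  linarith

end Factors

end Factorization

/-! ### Coupling with the tension variable, and the regions -/

section Main

variable {𝒳 𝒴 𝒜 ℬ : Type*}

lemma map_id_comp_injective {Ω α : Type*} (P : PMF Ω) {e : Ω → α} (he : Function.Injective e)
    (ω : Ω) : P.map e (e ω) = P ω := by
  have := map_comp_injective P id he ω
  rwa [PMF.map_id] at this

lemma Protocol.tsum_mul_le_one (Pi : Protocol 𝒳 𝒴 𝒜 ℬ) {f : 𝒳 → 𝒜 → Transcript → ℝ≥0∞}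
    {g : 𝒴 → ℬ → Transcript → ℝ≥0∞} (h : ∀ x y a b m, Pi.finalProb x y a b m = f x a m * g y b m)
    (x : 𝒳) (y : 𝒴) : ∑' (m) (a) (b), f x a m * g y b m ≤ 1 := by
  refine le_trans (le_of_eq ?_) (Pi.tsum_finalProb_le_one x y)
  simp only [h, ENNReal.tsum_prod']
  rw [ENNReal.tsum_comm]
  refine tsum_congr fun a => ?_
  rw [ENNReal.tsum_comm]

/-- The variable `Q`, jointly distributed with the inputs, can be coupled with a run of the protocol
so that it depends on the run only through the inputs. -/
lemma Protocol.Computes.exists_coupling {κ : Type*} {Pi : Protocol 𝒳 𝒴 𝒜 ℬ}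
    {p : PMF (𝒳 × 𝒴 × 𝒜 × ℬ)} {P : PMF (𝒳 × 𝒴 × 𝒜 × ℬ × Transcript)} (hP : Pi.Computes p P)
    {R : PMF (𝒴 × 𝒳 × κ)}
    (hR : R.map (fun ω => (ω.1, ω.2.1)) = p.map fun ω => (ω.2.1, ω.1)) :
    ∃ W : PMF (𝒳 × 𝒴 × 𝒜 × ℬ × Transcript × κ),
      W.map (fun ω => (ω.1, ω.2.1, ω.2.2.1, ω.2.2.2.1, ω.2.2.2.2.1)) = P ∧
      W.map (fun ω => (ω.2.1, ω.1, ω.2.2.2.2.2)) = R ∧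
      ∀ x y a b m q, W (x, y, a, b, m, q) = R (y, x, q) * Pi.finalProb x y a b m := by
  have hμ : ∀ x y, ∑' q, R (y, x, q) = p.map (fun ω => (ω.1, ω.2.1)) (x, y) := fun x y => by
    have h1 := map_comp_injective p (fun ω => (ω.1, ω.2.1)) Prod.swap_injective (x, y)
    rw [← h1]
    simp only [Prod.swap_prod_mk]
    rw [← hR, ← tsum_map_prod R (fun ω => (ω.1, ω.2.1)) fun ω => ω.2.2]
    exact tsum_congr fun q => (map_id_comp_injective R
      (e := fun ω => ((ω.1, ω.2.1), ω.2.2)) (fun s t h => by grind) (y, x, q)).symm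
  have hq : ∀ x y a b m, ∑' q, R (y, x, q) * Pi.finalProb x y a b m = P (x, y, a, b, m) :=
    fun x y a b m => by rw [ENNReal.tsum_mul_right, hμ, hP.1]
  have htot : ∑' t : 𝒳 × 𝒴 × 𝒜 × ℬ × Transcript × κ, R (t.2.1, t.1, t.2.2.2.2.2) *
      Pi.finalProb t.1 t.2.1 t.2.2.1 t.2.2.2.1 t.2.2.2.2.1 = 1 := by
    rw [← P.tsum_coe]
    simp only [ENNReal.tsum_prod', hq]
  obtain ⟨W, hW⟩ : ∃ W : PMF (𝒳 × 𝒴 × 𝒜 × ℬ × Transcript × κ), ∀ x y a b m q,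
      W (x, y, a, b, m, q) = R (y, x, q) * Pi.finalProb x y a b m :=
    ⟨⟨fun t => R (t.2.1, t.1, t.2.2.2.2.2) *
      Pi.finalProb t.1 t.2.1 t.2.2.1 t.2.2.2.1 t.2.2.2.2.1, htot ▸ ENNReal.summable.hasSum⟩,
      fun x y a b m q => rfl⟩
  refine ⟨W, ?_, ?_, hW⟩
  · ext ⟨x, y, a, b, m⟩
    rw [← tsum_map_prod W _ fun ω => ω.2.2.2.2.2, ← hq]
    refine tsum_congr fun q => ?_
    rw [← hW]
    exact map_id_comp_injective W
      (e := fun ω => ((ω.1, ω.2.1, ω.2.2.1, ω.2.2.2.1, ω.2.2.2.2.1), ω.2.2.2.2.2))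
      (fun s t h => by grind) (x, y, a, b, m, q)
  · ext ⟨y, x, q⟩
    rw [← tsum_map_prod W _ fun ω => (ω.2.2.1, ω.2.2.2.1, ω.2.2.2.2.1)]
    trans ∑' t : 𝒜 × ℬ × Transcript, R (y, x, q) * Pi.finalProb x y t.1 t.2.1 t.2.2
    · refine tsum_congr fun t => ?_
      rw [← hW]
      exact map_id_comp_injective W
        (e := fun ω => ((ω.2.1, ω.1, ω.2.2.2.2.2), (ω.2.2.1, ω.2.2.2.1, ω.2.2.2.2.1)))
        (fun s t h => by grind) (x, y, t.1, t.2.1, t.2.2, q)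
    rw [ENNReal.tsum_mul_left]
    rcases eq_or_ne (R (y, x, q)) 0 with h0 | h0
    · simp [h0]
    set μ := p.map (fun ω => (ω.1, ω.2.1)) (x, y) with hμdef
    have hμ0 : μ ≠ 0 := by
      rw [hμdef, ← hμ]
      exact fun h => h0 (ENNReal.tsum_eq_zero.1 h q)
    -- `P` has marginal `μ` at (x, y), so on inputs of positive probability the run finishes almost
    -- surely. This is what makes the marginal of `W` equal to `R`.
    have hmul : μ * ∑' t : 𝒜 × ℬ × Transcript, Pi.finalProb x y t.1 t.2.1 t.2.2 = μ * 1 := by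
      rw [mul_one, ← ENNReal.tsum_mul_left]
      simp only [hμdef, ← hP.1]
      conv_rhs => rw [← hP.2, PMF.map_comp]
      change _ = P.map (fun ω => (ω.1, ω.2.1)) (x, y)
      rw [← tsum_map_prod _ _ fun ω => ω.2.2]
      exact tsum_congr fun t => (map_id_comp_injective P
        (e := fun ω => ((ω.1, ω.2.1), ω.2.2)) (fun s t h => by grind) (x, y, t)).symm
    rw [(ENNReal.mul_right_inj hμ0 (PMF.apply_ne_top _ _)).1 hmul, mul_one]

/-- The transcript of a protocol factors through the inputs. -/
lemma Protocol.Computes.factors_const {Pi : Protocol 𝒳 𝒴 𝒜 ℬ} {p : PMF (𝒳 × 𝒴 × 𝒜 × ℬ)}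
    {P : PMF (𝒳 × 𝒴 × 𝒜 × ℬ × Transcript)} (hP : Pi.Computes p P) :
    ∃ f g, Factors P (fun ω => ω.1) (fun ω => ω.2.1) (fun ω => ω.2.2.1) (fun ω => ω.2.2.2.1)
      (fun ω => ω.2.2.2.2) (fun _ => ()) f g := by
  obtain ⟨f, g, hf, hg, h⟩ := Pi.exists_finalProb_eq_mul
  refine ⟨f, g, ⟨fun x y a b m q => ?_, hf, hg, Pi.tsum_mul_le_one h⟩⟩
  have h1 := map_id_comp_injective P
    (e := fun ω => (ω.1, ω.2.1, ω.2.2.1, ω.2.2.2.1, ω.2.2.2.2, q)) (fun s t h => by grind)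
    (x, y, a, b, m)
  have h2 := map_comp_injective P (fun ω => (ω.1, ω.2.1)) (e := fun t => (t.1, t.2, q))
    (fun s t h => by grind) (x, y)
  simp only at h1 h2
  refine h1.trans ?_
  rw [hP.1, h]
  congr 1
  refine Eq.trans ?_ h2.symm
  rw [← hP.2, PMF.map_comp]
  rfl

variable [Fintype 𝒳] [Fintype 𝒴] [Fintype 𝒜] [Fintype ℬ]

/-- Region differences lie in the nonnegative quadrant, so the shifted point must be shown to have
nonnegative coordinates. -/
lemma Protocol.Computes.sub_le {Pi : Protocol 𝒳 𝒴 𝒜 ℬ} {p : PMF (𝒳 × 𝒴 × 𝒜 × ℬ)}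
    {P : PMF (𝒳 × 𝒴 × 𝒜 × ℬ × Transcript)} (hP : Pi.Computes p P) :
    entropyBY p - entropyABXY p ≤
        condMutualInfo P (fun ω => ω.1) (fun ω => ω.2.2.2.2) (fun ω => ω.2.1) ∧
      entropyAX p - entropyABXY p ≤
        condMutualInfo P (fun ω => ω.2.1) (fun ω => ω.2.2.2.2) (fun ω => ω.1) := by
  obtain ⟨f, g, h⟩ := hP.factors_const
  have h1 := h.condEntropy_sub_le
  have h2 := h.symm.condEntropy_sub_le
  have h3 := condEntropy_comp_injective P (fun ω => (ω.2.2.1, ω.2.2.2.1)) (fun ω => (ω.1, ω.2.1))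
    Prod.swap_injective Prod.swap_injective
  simp only [Prod.swap_prod_mk] at h3
  rw [h3] at h2
  rw [← hP.2]
  simp only [entropyBY, entropyAX, entropyABXY, condEntropy_map]
  exact ⟨h1, h2⟩

/-- Adjoining the transcript to `Q` carries a point of the tension region of the inputs to a point of
the tension region of the views. -/
lemma Protocol.Computes.add_mem_tensionRegion {Pi : Protocol 𝒳 𝒴 𝒜 ℬ} {p : PMF (𝒳 × 𝒴 × 𝒜 × ℬ)}
    {P : PMF (𝒳 × 𝒴 × 𝒜 × ℬ × Transcript)} (hP : Pi.Computes p P) {r₁ r₂ t₁ t₂ c : ℝ}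
    (h₁ : condMutualInfo P (fun ω => ω.1) (fun ω => ω.2.2.2.2) (fun ω => ω.2.1) ≤ r₁)
    (h₂ : condMutualInfo P (fun ω => ω.2.1) (fun ω => ω.2.2.2.2) (fun ω => ω.1) ≤ r₂)
    (ht : (t₁, t₂, c) ∈ tensionRegion (p.map fun ω => (ω.2.1, ω.1))) :
    (r₁ - (entropyBY p - entropyABXY p) + t₁, r₂ - (entropyAX p - entropyABXY p) + t₂, c) ∈
      tensionRegion (p.map fun ω => ((ω.2.2.2, ω.2.1), (ω.2.2.1, ω.1))) := by
  obtain ⟨κ, R, hR, k₁, k₂, k₃⟩ := ht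
  obtain ⟨W, hWP, hWR, hW⟩ := hP.exists_coupling hR
  obtain ⟨f, g, hf, hg, hfg⟩ := Pi.exists_finalProb_eq_mul
  have F : Factors W (fun ω => ω.1) (fun ω => ω.2.1) (fun ω => ω.2.2.1) (fun ω => ω.2.2.2.1)
      (fun ω => ω.2.2.2.2.1) (fun ω => ω.2.2.2.2.2) f g := by
    refine ⟨fun x y a b m q => ?_, hf, hg, Pi.tsum_mul_le_one hfg⟩
    have h1 := map_comp_injective W (fun ω => (ω.1, ω.2.1, ω.2.2.2.2.2))
      (e := fun t => (t.2.1, t.1, t.2.2)) (fun s t h => by grind) (x, y, q)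
    simp only at h1
    rw [← h1, hWR, ← hfg, ← hW]
    exact map_id_comp_injective W Function.injective_id (x, y, a, b, m, q)
  have hWp : W.map (fun ω => (ω.1, ω.2.1, ω.2.2.1, ω.2.2.2.1)) = p := by
    rw [← hP.2, ← hWP, PMF.map_comp]
    rfl
  have I1 := F.condEntropy_add_le
  have I2 := F.symm.condEntropy_add_le
  have I3 := F.condMutualInfo_le
  have C1 := condEntropy_chain W (fun ω => ω.1) (fun ω => ω.2.1) (fun ω => ω.2.2.1)
    (fun ω => ω.2.2.2.1)
  have C2 := condEntropy_chain W (fun ω => ω.2.1) (fun ω => ω.1) (fun ω => ω.2.2.2.1)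
    (fun ω => ω.2.2.1)
  have C3 := condEntropy_comp_injective W (fun ω => (ω.2.2.1, ω.2.2.2.1)) (fun ω => (ω.1, ω.2.1))
    Prod.swap_injective Prod.swap_injective
  simp only [Prod.swap_prod_mk] at C3
  rw [C3] at C2
  rw [← hWP] at h₁ h₂
  rw [← hWR] at k₁ k₂ k₃
  simp only [condMutualInfo, condEntropy_map] at h₁ h₂ k₁ k₂ k₃ I3
  -- The new tension variable is the pair (Q, M). Its first two bounds combine `I1` with `C1` and
  -- `I2` with `C2`; the third is `I3`.
  refine ⟨κ × Transcript, W.map fun ω =>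
    ((ω.2.2.2.1, ω.2.1), (ω.2.2.1, ω.1), (ω.2.2.2.2.2, ω.2.2.2.2.1)), ?_, ?_, ?_, ?_⟩
  · rw [← hWp, PMF.map_comp, PMF.map_comp]
    rfl
  all_goals
    rw [← hWp]
    simp only [entropyBY, entropyAX, entropyABXY, condMutualInfo, condEntropy_map]
    linarith

lemma tensionSlice_mono {α β : Type*} [Fintype α] [Fintype β] {c : ℝ} {p : PMF (α × β)}
    {r s : ℝ × ℝ} (hr : r ∈ tensionSlice c p) (h : r ≤ s) : s ∈ tensionSlice c p := by
  obtain ⟨h1, h2, κ, P, hP, k1, k2, k3⟩ := hr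
  exact ⟨h1.trans h.1, h2.trans h.2, κ, P, hP, k1.trans h.1, k2.trans h.2, k3⟩

/-- Tension slices are closed upwards. When the shift is nonnegative, the original point dominates
the shifted one and so stays in the region. -/
lemma outerRegion_mono {p : PMF (𝒳 × 𝒴 × 𝒜 × ℬ)} {r s : ℝ × ℝ} (hr : r ∈ outerRegion p)
    (h : r ≤ s) : s ∈ outerRegion p := by
  simp only [outerRegion, Set.mem_iInter] at hr ⊢
  intro c hc
  obtain ⟨h1, h2, h3⟩ := hr c hc
  refine ⟨h1.trans h.1, h2.trans h.2, ?_⟩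
  rintro _ ⟨t, ht, rfl⟩
  exact tensionSlice_mono (h3 ⟨t, ht, rfl⟩) (add_le_add_left h t)

lemma sub_mem_outerRegion {p : PMF (𝒳 × 𝒴 × 𝒜 × ℬ)} {r : ℝ × ℝ} (hr : r ∈ icRegion p) :
    (r.1 - (entropyBY p - entropyABXY p), r.2 - (entropyAX p - entropyABXY p)) ∈
      outerRegion p := by
  obtain ⟨-, -, Pi, P, hP, h1, h2⟩ := hr
  have h3 := sub_nonneg.2 (hP.sub_le.1.trans h1)
  have h4 := sub_nonneg.2 (hP.sub_le.2.trans h2)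
  simp only [outerRegion, Set.mem_iInter]
  refine fun c _ => ⟨h3, h4, ?_⟩
  rintro _ ⟨t, ⟨t1, t2, ht⟩, rfl⟩
  exact ⟨add_nonneg h3 t1, add_nonneg h4 t2, hP.add_mem_tensionRegion h1 h2 ht⟩

end Main

end TwoParty

theorem mainTheorem2 {𝒳 𝒴 𝒜 ℬ : Type*} [Fintype 𝒳] [Fintype 𝒴] [Fintype 𝒜] [Fintype ℬ]
    (p : PMF (𝒳 × 𝒴 × 𝒜 × ℬ)) :
    TwoParty.icRegion p ⊆ TwoParty.shiftedOuterRegion p ∧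
    (TwoParty.entropyABXY p ≤ TwoParty.entropyAX p →
      TwoParty.entropyABXY p ≤ TwoParty.entropyBY p →
      TwoParty.icRegion p ⊆ TwoParty.outerRegion p) := by
  refine ⟨fun r hr => ⟨_, TwoParty.sub_mem_outerRegion hr, ?_⟩, fun hA hB r hr =>
    TwoParty.outerRegion_mono (TwoParty.sub_mem_outerRegion hr) ?_⟩
  · ext <;> simp
  · exact ⟨sub_le_self _ (sub_nonneg.2 hB), sub_le_self _ (sub_nonneg.2 hA)⟩
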